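/- For $n\in\mathbb{Z}_{>0}$, $\beta>0$ and real parameters $a_i,b_i,c_i,s_i$ ($1\le i\le n$), a (planar) patchwork of width $n$ is a subset of $\mathbb{R}^2$ of one of the following two forms: the set of $(x,y)$ at which $$F(x,y)=\frac1\beta\log\sum_{i=1}^n s_i\exp\bigl(\beta(a_ix+b_iy+c_i)\bigr)$$ is defined (the sum is positive) and $F(x,y)=0$; or (the limiting case $\beta=+\infty$) the set of $(x,y)$ with $f(x,y)=0$, where $$f(x,y)=\max_{i:\,s_i>0}(a_ix+b_iy+c_i)-\max_{i:\,s_i<0}(a_ix+b_iy+c_i)$$ (understood to be empty unless both signs occur among the $s_i$). A Jordan curve is the image of an injective continuous map of a circle into the Euclidean plane; it is called smooth if it has such a parametrization that, as a function of the angle, is continuously differentiable with nowhere vanishing derivative (in particular, all $C^\infty$ embedded closed curves are smooth). **Theorem (Expressive power).** 1. For every Jordan curve $\Gamma$ and every $\varepsilon>0$ there is a patchwork within Hausdorff distance $\varepsilon$ of $\Gamma$. 2. For every smooth Jordan curve $\Gamma$ there is a constant $C>0$ such that for every $0<\varepsilon\le 1$ there is a patchwork of width at most $C/\varepsilon^2$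 within Hausdorff distance $\varepsilon$ of $\Gamma$. 3. The patchwork in part 2 can be built from an affine honeycomb lattice with explicit parameters: if $\Gamma$ is a smooth Jordan curve contained in the box $|x|,|y|<R$, then there is a constant $C>0$ such that for every $0<\varepsilon\le1$ there are an integer $N\ge1$ and signs $s_{k,l}\in\{+1,-1\}$ ($k,l\in\mathbb{Z}$, $-N\le k,l\le N$) such that the patchwork with $\beta=+\infty$ and parameters $$a_{k,l}=\frac kR,\qquad b_{k,l}=\frac lR,\qquad c_{k,l}=-\frac{k^2+l^2+kl-1}{N},\qquad s_{k,l},$$ whose width is $(2N+1)^2\le C/\varepsilon^2$, is within Hausdorff distance $\varepsilon$ of $\Gamma$. -/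

import Mathlib

/-- The Euclidean plane. -/
abbrev Plane : Type := EuclideanSpace ℝ (Fin 2)

/-- The real parameters of a planar patchwork whose terms are indexed by `ι`;
the width is the number of elements of `ι`. -/
structure PatchworkParams (ι : Type) where
  a : ι → ℝ
  b : ι → ℝ
  c : ι → ℝ
  s : ι → ℝ

namespace PatchworkParams

variable {ι : Type} [Fintype ι]

/-- The affine function `l_i(x, y) = a_i x + b_i y + c_i`. -/
def lin (P : PatchworkParams ι) (i : ι) (p : Plane) : ℝ :=
  P.a i * p 0 + P.b i * p 1 + P.c i

/-- The sum `∑ s_i exp (β l_i(x, y))` under the logarithm. -/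
noncomputable def expSum (P : PatchworkParams ι) (β : ℝ) (p : Plane) : ℝ :=
  ∑ i, P.s i * Real.exp (β * P.lin i p)

/-- The patchwork field `F` for finite `β`; it is meaningful where `expSum` is positive. -/
noncomputable def field (P : PatchworkParams ι) (β : ℝ) (p : Plane) : ℝ :=
  1 / β * Real.log (P.expSum β p)

/-- The patchwork `F(x, y) = 0` for finite `β`. The positivity condition says that `F(x, y)` is
defined, since `Real.log` takes conventional values outside the positive half-line. -/
def curve (P : PatchworkParams ι) (β : ℝ) : Set Plane :=
  {p | 0 < P.expSum β p ∧ P.field β p = 0}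

/-- The limiting field `f` for `β = +∞`; it is meaningful if both signs occur among the `s_i`. -/
noncomputable def limitField (P : PatchworkParams ι) (p : Plane) : ℝ :=
  (⨆ i : {i // 0 < P.s i}, P.lin i.1 p) - ⨆ i : {i // P.s i < 0}, P.lin i.1 p

/-- The patchwork `f(x, y) = 0` for `β = +∞`. The first two conditions say that both maxima
are taken over nonempty sets. -/
def limitCurve (P : PatchworkParams ι) : Set Plane :=
  {p | (∃ i, 0 < P.s i) ∧ (∃ i, P.s i < 0) ∧ P.limitField p = 0}

end PatchworkParams

/-- `S` is a planar patchwork of width `n`, with finite `β` or with `β = +∞`. -/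
def IsPatchworkOfWidth (n : ℕ) (S : Set Plane) : Prop :=
  0 < n ∧ ∃ P : PatchworkParams (Fin n), (∃ β : ℝ, 0 < β ∧ S = P.curve β) ∨ S = P.limitCurve

/-- The pairs `(k, l)` of integers with `-N ≤ k, l ≤ N`. -/
abbrev HexIndex (N : ℕ) : Type :=
  ↥(Finset.Icc (-(N : ℤ)) (N : ℤ)) × ↥(Finset.Icc (-(N : ℤ)) (N : ℤ))

/-- The parameters `a = k`, `b = l`, `c = -(k² + l² + kl - 1) / N` of the affine honeycomb lattice
of step `1 / N`, adapted from the box `|x|, |y| < 1` to the box `|x|, |y| < R` by replacing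
`(x, y)` with `(x / R, y / R)`. -/
noncomputable def hexParams (R : ℝ) (N : ℕ) (s : HexIndex N → ℝ) : PatchworkParams (HexIndex N) where
  a i := ((i.1 : ℤ) : ℝ) / R
  b i := ((i.2 : ℤ) : ℝ) / R
  c i := -((((i.1 : ℤ) : ℝ) ^ 2 + ((i.2 : ℤ) : ℝ) ^ 2 + ((i.1 : ℤ) : ℝ) * ((i.2 : ℤ) : ℝ) - 1) / N)
  s := s

/-- The hex-curve for the box `|x|, |y| < R`: the patchwork with `β = +∞` and the honeycomb
parameters. -/
noncomputable def hexCurve (R : ℝ) (N : ℕ) (s : HexIndex N → ℝ) : Set Plane :=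
  (hexParams R N s).limitCurve

/-- A Jordan curve: the image of an injective continuous map of the circle into the plane. -/
def IsJordanCurve (Γ : Set Plane) : Prop :=
  ∃ γ : Circle → Plane, Continuous γ ∧ Function.Injective γ ∧ Set.range γ = Γ

/-- A smooth Jordan curve, in the weakest usual sense: it has a regular parametrization of class
`C¹` by the circle (in particular, every `C^∞` embedded closed curve qualifies). -/
def IsSmoothJordanCurve (Γ : Set Plane) : Prop :=
  ∃ γ : Circle → Plane, Continuous γ ∧ Function.Injective γ ∧
    ContDiff ℝ 1 (fun t : ℝ => γ (Circle.exp t)) ∧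
    (∀ t : ℝ, deriv (fun u : ℝ => γ (Circle.exp u)) t ≠ 0) ∧ Set.range γ = Γ

/-! After scaling by `N / R`, the region where the term of `(k, l)` is maximal is a hexagonal cell
centred at `(2k + l, k + 2l)`, except for indices on the border of the square; the shift `+1` in `c`
is common to all terms and cancels. The approximating curve need not be connected. Give `+1` to the
sites with both coordinates even that are near the target `G`, and `-1` to all others. The zero set
then consists of outlines of isolated hexagons of size `O(R / N)` dotted along `G`. Each of its
points lies in a positive cell, hence near `G` (`abs_sub_center_le`). Each point of `G` is near a
positive cell (`exists_even_site`), whose edge towards `(k + 1, l)` lies on the curve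
(`lin_edgeCenter_le`, `lin_edgeCenter_eq`). Taking `N` of order `R / ε` gives width `O(1 / ε ^ 2)`.
-/

namespace PatchworkParams

section Reindex

variable {ι κ : Type}

/-- Relabelling the terms of a patchwork. -/
def reindex (P : PatchworkParams ι) (e : κ ≃ ι) : PatchworkParams κ where
  a := P.a ∘ e
  b := P.b ∘ e
  c := P.c ∘ e
  s := P.s ∘ e

theorem limitField_reindex (P : PatchworkParams ι) (e : κ ≃ ι) (p : Plane) :
    (P.reindex e).limitField p = P.limitField p := by
  unfold limitField
  congr 1
  · exact Equiv.iSup_congr (e.subtypeEquiv fun _ => Iff.rfl) fun _ => rfl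
  · exact Equiv.iSup_congr (e.subtypeEquiv fun _ => Iff.rfl) fun _ => rfl

theorem limitCurve_reindex (P : PatchworkParams ι) (e : κ ≃ ι) :
    (P.reindex e).limitCurve = P.limitCurve := by
  ext p
  simp only [limitCurve, Set.mem_ofPred_eq, limitField_reindex]
  refine and_congr ?_ (and_congr ?_ Iff.rfl)
  · exact e.exists_congr_left.trans (by simp [reindex])
  · exact e.exists_congr_left.trans (by simp [reindex])

theorem isPatchworkOfWidth_limitCurve [Fintype ι] (P : PatchworkParams ι) {n : ℕ} (hn : 0 < n)
    (h : Fintype.card ι = n) : IsPatchworkOfWidth n P.limitCurve :=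
  ⟨hn, P.reindex (Fintype.equivFinOfCardEq h).symm, Or.inr (limitCurve_reindex P _).symm⟩

/-- On the limit curve some positive term is maximal among all terms with nonzero sign. -/
theorem exists_isMax_of_mem_limitCurve [Finite ι] {P : PatchworkParams ι} (hs : ∀ i, P.s i ≠ 0) {p : Plane}
    (hp : p ∈ P.limitCurve) : ∃ v, 0 < P.s v ∧ ∀ i, P.lin i p ≤ P.lin v p := by
  obtain ⟨⟨i, hi⟩, -, h⟩ := hp
  have : Nonempty {i // 0 < P.s i} := ⟨⟨i, hi⟩⟩
  obtain ⟨v, hv⟩ := exists_eq_ciSup_of_finite (f := fun i : {i // 0 < P.s i} => P.lin i.1 p)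
  refine ⟨v.1, v.2, fun j => ?_⟩
  rw [limitField, sub_eq_zero] at h
  rcases lt_or_gt_of_ne (hs j) with hj | hj
  · rw [hv, h]
    exact le_ciSup (f := fun i : {i // P.s i < 0} => P.lin i.1 p) (Set.finite_range _).bddAbove
      ⟨j, hj⟩
  · rw [hv]
    exact le_ciSup (f := fun i : {i // 0 < P.s i} => P.lin i.1 p) (Set.finite_range _).bddAbove
      ⟨j, hj⟩

/-- A point at which a positive and a negative term are both maximal lies on the limit curve. -/
theorem mem_limitCurve_of_isMax [Finite ι] {P : PatchworkParams ι} {p : Plane} {v w : ι} (hv : 0 < P.s v)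
    (hw : P.s w < 0) (hvmax : ∀ i, P.lin i p ≤ P.lin v p) (heq : P.lin w p = P.lin v p) :
    p ∈ P.limitCurve := by
  have : Nonempty {i // 0 < P.s i} := ⟨⟨v, hv⟩⟩
  have : Nonempty {i // P.s i < 0} := ⟨⟨w, hw⟩⟩
  refine ⟨⟨v, hv⟩, ⟨w, hw⟩, ?_⟩
  rw [limitField, sub_eq_zero]
  refine le_antisymm ?_ ?_
  · rw [← heq] at hvmax
    exact ciSup_le fun i => (hvmax i).trans
      (le_ciSup (f := fun i : {i // P.s i < 0} => P.lin i.1 p) (Set.finite_range _).bddAbove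
        ⟨w, hw⟩)
  · exact ciSup_le fun i => (hvmax i).trans
      (le_ciSup (f := fun i : {i // 0 < P.s i} => P.lin i.1 p) (Set.finite_range _).bddAbove
        ⟨v, hv⟩)

end Reindex

end PatchworkParams

/-! ### Geometry of the honeycomb cells -/

theorem card_hexIndex (N : ℕ) : Fintype.card (HexIndex N) = (2 * N + 1) ^ 2 := by
  have h : (N : ℤ) + 1 - -(N : ℤ) = ((2 * N + 1 : ℕ) : ℤ) := by push_cast; ring
  rw [Fintype.card_prod, Fintype.card_coe, Int.card_Icc, h, Int.toNat_natCast, sq]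

theorem isPatchworkOfWidth_hexCurve (R : ℝ) (N : ℕ) (s : HexIndex N → ℝ) :
    IsPatchworkOfWidth ((2 * N + 1) ^ 2) (hexCurve R N s) :=
  PatchworkParams.isPatchworkOfWidth_limitCurve _ (by positivity) (card_hexIndex N)

/-- The pair `(k, l)` as an index. -/
def HexIndex.mk {N : ℕ} (k l : ℤ) (hk : |k| ≤ N) (hl : |l| ≤ N) : HexIndex N :=
  (⟨k, Finset.mem_Icc.2 (abs_le.1 hk)⟩, ⟨l, Finset.mem_Icc.2 (abs_le.1 hl)⟩)

theorem lin_hexParams_mk (R : ℝ) {N : ℕ} (s : HexIndex N → ℝ) (k l : ℤ) (hk : |k| ≤ N)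
    (hl : |l| ≤ N) (p : Plane) : (hexParams R N s).lin (HexIndex.mk k l hk hl) p =
      k * (p 0 / R) + l * (p 1 / R) - ((k : ℝ) ^ 2 + l ^ 2 + k * l - 1) / N := by
  simp only [PatchworkParams.lin, hexParams, HexIndex.mk]
  ring

/-- If an index in the interior of the index square is maximal at `p`, then `p` lies in the
hexagonal cell of that index, and so is close to its centre. -/
theorem abs_sub_center_le {R : ℝ} {N : ℕ} (hN : 0 < N) (s : HexIndex N → ℝ) {k l : ℤ}
    (hk : |k| < N) (hl : |l| < N) {p : Plane}
    (hmax : ∀ i, (hexParams R N s).lin i p ≤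
      (hexParams R N s).lin (HexIndex.mk k l hk.le hl.le) p) :
    |N * (p 0 / R) - (2 * k + l)| ≤ 1 ∧ |N * (p 1 / R) - (k + 2 * l)| ≤ 1 := by
  have hN' : (0 : ℝ) < N := by exact_mod_cast hN
  have key : ∀ m n : ℤ, |k + m| ≤ N → |l + n| ≤ N →
      m * (N * (p 0 / R) - (2 * k + l)) + n * (N * (p 1 / R) - (k + 2 * l)) ≤
        (m : ℝ) ^ 2 + n ^ 2 + m * n := by
    intro m n hm hn
    have h := hmax (HexIndex.mk (k + m) (l + n) hm hn)
    rw [lin_hexParams_mk, lin_hexParams_mk] at h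
    have h' := mul_le_mul_of_nonneg_left h hN'.le
    rw [mul_sub, mul_sub, mul_div_cancel₀ _ hN'.ne', mul_div_cancel₀ _ hN'.ne'] at h'
    push_cast at h'
    linarith
  rw [abs_lt] at hk hl
  -- Four neighbours suffice; the strict bounds on `k` and `l` keep them inside the index square.
  have h1 := key 1 0 (by rw [abs_le]; omega) (by rw [abs_le]; omega)
  have h2 := key (-1) 0 (by rw [abs_le]; omega) (by rw [abs_le]; omega)
  have h3 := key 0 1 (by rw [abs_le]; omega) (by rw [abs_le]; omega)
  have h4 := key 0 (-1) (by rw [abs_le]; omega) (by rw [abs_le]; omega)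
  push_cast at h1 h2 h3 h4
  constructor <;> rw [abs_le] <;> constructor <;> linarith

/-- The centre of the edge between the cells of `(k, l)` and `(k + 1, l)`. -/
noncomputable def edgeCenter (R : ℝ) (N : ℕ) (k l : ℤ) : Plane :=
  !₂[R * ((2 * k + l + 1) / N), R * ((k + 2 * l + 1 / 2) / N)]

/-- Four times the difference of the two sides is `(2m + n - 1)² + 3n² - 1`. This is nonnegative if
`n ≠ 0`, and for `n = 0` because `2m - 1` is odd. -/
theorem mul_le_sq_add_sq_of_int (m n : ℤ) :
    (m : ℝ) + n / 2 ≤ (m : ℝ) ^ 2 + n ^ 2 + m * n := by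
  have h : 2 * m + n ≤ 2 * (m ^ 2 + n ^ 2 + m * n) := by
    rcases eq_or_ne n 0 with rfl | hn
    · nlinarith [Int.le_self_sq m]
    · have : 1 ≤ n ^ 2 := Int.one_le_abs hn |> fun h => by nlinarith [sq_abs n]
      nlinarith [sq_nonneg (2 * m - 1 + n)]
  have h' : (2 * m + n : ℝ) ≤ 2 * (m ^ 2 + n ^ 2 + m * n) := by exact_mod_cast h
  linarith

/-- The edge centre has offset `(1, 1/2)` from the cell centre, so `N` times the gap between the two
terms is the quadratic form at the index difference minus its pairing with `(1, 1/2)`. -/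
theorem lin_edgeCenter_le {R : ℝ} (hR : 0 < R) {N : ℕ} (hN : 0 < N) (s : HexIndex N → ℝ)
    {k l : ℤ} (hk : |k| ≤ N) (hl : |l| ≤ N) (i : HexIndex N) :
    (hexParams R N s).lin i (edgeCenter R N k l) ≤
      (hexParams R N s).lin (HexIndex.mk k l hk hl) (edgeCenter R N k l) := by
  have hN' : (0 : ℝ) < N := by exact_mod_cast hN
  obtain ⟨⟨m, hm⟩, ⟨n, hn⟩⟩ := i
  have hi := lin_hexParams_mk R s m n (abs_le.2 (Finset.mem_Icc.1 hm))
    (abs_le.2 (Finset.mem_Icc.1 hn)) (edgeCenter R N k l)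
  rw [HexIndex.mk] at hi
  rw [hi, lin_hexParams_mk]
  simp only [edgeCenter, PiLp.toLp_apply, Matrix.cons_val_zero, Matrix.cons_val_one]
  have h := mul_le_sq_add_sq_of_int (m - k) (n - l)
  push_cast at h
  rw [mul_div_cancel_left₀ _ hR.ne', mul_div_cancel_left₀ _ hR.ne']
  simp only [mul_div_assoc', ← add_div, ← sub_div]
  gcongr ?_ / _
  linarith

theorem lin_edgeCenter_eq {R : ℝ} (hR : 0 < R) {N : ℕ} (hN : 0 < N) (s : HexIndex N → ℝ)
    {k l : ℤ} (hk : |k| ≤ N) (hk' : |k + 1| ≤ N) (hl : |l| ≤ N) :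
    (hexParams R N s).lin (HexIndex.mk (k + 1) l hk' hl) (edgeCenter R N k l) =
      (hexParams R N s).lin (HexIndex.mk k l hk hl) (edgeCenter R N k l) := by
  have hN' : (N : ℝ) ≠ 0 := by exact_mod_cast hN.ne'
  rw [lin_hexParams_mk, lin_hexParams_mk]
  simp only [edgeCenter, PiLp.toLp_apply, Matrix.cons_val_zero, Matrix.cons_val_one]
  rw [mul_div_cancel_left₀ _ hR.ne', mul_div_cancel_left₀ _ hR.ne']
  field_simp
  push_cast
  ring

theorem exists_int_abs_le_abs_sub_le (t : ℝ) : ∃ m : ℤ, |(m : ℝ)| ≤ |t| ∧ |t - m| ≤ 1 := by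
  rcases le_total 0 t with ht | ht
  · have h0 : (0 : ℝ) ≤ ⌊t⌋ := by exact_mod_cast Int.floor_nonneg.2 ht
    refine ⟨⌊t⌋, ?_, ?_⟩
    · rw [abs_of_nonneg h0, abs_of_nonneg ht]
      exact Int.floor_le t
    · rw [abs_le]
      constructor <;> linarith [Int.floor_le t, Int.lt_floor_add_one t]
  · have h0 : (⌈t⌉ : ℝ) ≤ 0 := by exact_mod_cast Int.ceil_le.2 (by simpa using ht)
    refine ⟨⌈t⌉, ?_, ?_⟩
    · rw [abs_of_nonpos h0, abs_of_nonpos ht]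
      linarith [Int.le_ceil t]
    · rw [abs_le]
      constructor <;> linarith [Int.le_ceil t, Int.ceil_lt_add_one t]

/-! ### Choice of signs -/

/-- The centre of the cell of `(k, l)` lies within sup-distance `6 R / N` of a point of `G`. -/
def IsSiteNear (G : Set Plane) (R : ℝ) (N : ℕ) (k l : ℤ) : Prop :=
  ∃ q ∈ G, |N * (q 0 / R) - (2 * k + l)| ≤ 6 ∧ |N * (q 1 / R) - (k + 2 * l)| ≤ 6

/-- The sites that carry a positive sign: sites of the even sublattice, in the interior of the
index square and near `G`. Their cells are pairwise disjoint. -/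
def IsPositiveSite (G : Set Plane) (R : ℝ) (N : ℕ) (k l : ℤ) : Prop :=
  Even k ∧ Even l ∧ |k| < N ∧ |l| < N ∧ IsSiteNear G R N k l

open Classical in
/-- The signs of the hex-curve that approximates `G`. -/
noncomputable def hexSign (G : Set Plane) (R : ℝ) (N : ℕ) (i : HexIndex N) : ℝ :=
  if IsPositiveSite G R N i.1 i.2 then 1 else -1

theorem hexSign_eq_one_or (G : Set Plane) (R : ℝ) (N : ℕ) (i : HexIndex N) :
    hexSign G R N i = 1 ∨ hexSign G R N i = -1 := by
  unfold hexSign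
  split_ifs <;> simp

theorem hexSign_pos_iff {G : Set Plane} {R : ℝ} {N : ℕ} {i : HexIndex N} :
    0 < hexSign G R N i ↔ IsPositiveSite G R N i.1 i.2 := by
  unfold hexSign
  split_ifs with h <;> simp [h]

theorem hexSign_neg_iff {G : Set Plane} {R : ℝ} {N : ℕ} {i : HexIndex N} :
    hexSign G R N i < 0 ↔ ¬ IsPositiveSite G R N i.1 i.2 := by
  unfold hexSign
  split_ifs with h <;> simp [h]

/-- Every point of the box has a nearby site of the even sublattice in the interior of the index
square: truncate its lattice coordinates towards zero. -/
theorem exists_even_site {R : ℝ} (hR : 0 < R) {N : ℕ} (hN : 0 < N) {q : Plane}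
    (h0 : |q 0| < R) (h1 : |q 1| < R) :
    ∃ k l : ℤ, Even k ∧ Even l ∧ |k| < N ∧ |l| < N ∧
      |N * (q 0 / R) - (2 * k + l)| ≤ 6 ∧ |N * (q 1 / R) - (k + 2 * l)| ≤ 6 := by
  have hN' : (0 : ℝ) < N := by exact_mod_cast hN
  -- Solving `2k + l = N x`, `k + 2l = N y` gives `k = N (2x - y) / 3`, and `l` by symmetry. Errors
  -- of at most 2 in `k` and `l` move the centre by at most `2 * 2 + 2 = 6`.
  have coord : ∀ x y : ℝ, |x| < 1 → |y| < 1 →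
      ∃ k : ℤ, Even k ∧ |k| < N ∧ |N * (2 * x - y) / 3 - k| ≤ 2 := by
    intro x y hx hy
    obtain ⟨m, hm, hm'⟩ := exists_int_abs_le_abs_sub_le (N * (2 * x - y) / 6)
    refine ⟨2 * m, even_two_mul m, ?_, ?_⟩
    -- Here `|2x - y| < 3`; truncation towards zero preserves the strict bound.
    · have hlt : |N * (2 * x - y) / 6| < (N : ℝ) / 2 := by
        rw [abs_lt] at hx hy ⊢
        constructor <;> nlinarith
      have : |((2 * m : ℤ) : ℝ)| < N := by
        push_cast
        rw [abs_mul, abs_two]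
        linarith
      exact_mod_cast this
    · push_cast
      rw [abs_le] at hm' ⊢
      constructor <;> linarith
  have hx : |q 0 / R| < 1 := by rwa [abs_div, abs_of_pos hR, div_lt_one hR]
  have hy : |q 1 / R| < 1 := by rwa [abs_div, abs_of_pos hR, div_lt_one hR]
  obtain ⟨k, hk, hkN, hkd⟩ := coord _ _ hx hy
  obtain ⟨l, hl, hlN, hld⟩ := coord _ _ hy hx
  refine ⟨k, l, hk, hl, hkN, hlN, ?_, ?_⟩ <;> rw [abs_le] at hkd hld ⊢ <;>
    constructor <;> linarith

/-! ### Hausdorff distance and width -/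

theorem edist_le_of_abs_sub_le {R : ℝ} (hR : 0 < R) {N : ℕ} (hN : 0 < N) {ε : ℝ}
    (hε : 16 * R ≤ N * ε) {p q : Plane} (h0 : |N * (p 0 / R) - N * (q 0 / R)| ≤ 8)
    (h1 : |N * (p 1 / R) - N * (q 1 / R)| ≤ 8) : edist p q ≤ ENNReal.ofReal ε := by
  have hN' : (0 : ℝ) < N := by exact_mod_cast hN
  have conv : ∀ x y : ℝ, |N * (x / R) - N * (y / R)| ≤ 8 → |x - y| ≤ ε / 2 := by
    intro x y h
    have e : N * (x / R) - N * (y / R) = (N / R) * (x - y) := by ring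
    rw [e, abs_mul, abs_of_pos (by positivity), div_mul_eq_mul_div, div_le_iff₀ hR] at h
    refine le_of_mul_le_mul_left ?_ hN'
    linarith
  have h0' := conv _ _ h0
  have h1' := conv _ _ h1
  have hε0 : 0 ≤ ε := by linarith [abs_nonneg (p 0 - q 0)]
  rw [edist_dist]
  refine ENNReal.ofReal_le_ofReal ?_
  rw [EuclideanSpace.dist_eq, Fin.sum_univ_two, Real.dist_eq, Real.dist_eq]
  refine Real.sqrt_le_iff.2 ⟨hε0, ?_⟩
  nlinarith [abs_nonneg (p 0 - q 0), abs_nonneg (p 1 - q 1)]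

/-- The hex-curve with signs `hexSign` approximates `G` with an error of order `R / N`. -/
theorem hausdorffEDist_hexCurve_le {G : Set Plane} {R : ℝ} (hR : 0 < R)
    (hG : ∀ p ∈ G, |p 0| < R ∧ |p 1| < R) {N : ℕ} (hN : 0 < N) {ε : ℝ} (hε : 16 * R ≤ N * ε) :
    Metric.hausdorffEDist (hexCurve R N (hexSign G R N)) G ≤ ENNReal.ofReal ε := by
  have hN' : (0 : ℝ) < N := by exact_mod_cast hN
  refine Metric.hausdorffEDist_le_of_mem_edist ?_ ?_
  · intro p hp
    obtain ⟨⟨⟨k, hk⟩, ⟨l, hl⟩⟩, hv, hmax⟩ := PatchworkParams.exists_isMax_of_mem_limitCurve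
      (fun i => by rcases hexSign_eq_one_or G R N i with h | h <;> simp [hexParams, h]) hp
    obtain ⟨-, -, hkN, hlN, q, hq, hq0, hq1⟩ := hexSign_pos_iff.1 hv
    obtain ⟨hp0, hp1⟩ := abs_sub_center_le hN _ hkN hlN hmax
    -- The point is within 1 of the cell centre and the centre within 6 of `q`: 7 in total, below
    -- the allowed 8.
    refine ⟨q, hq, edist_le_of_abs_sub_le hR hN hε ?_ ?_⟩ <;>
      rw [abs_le] at hq0 hq1 hp0 hp1 ⊢ <;> constructor <;> linarith
  · intro q hq
    obtain ⟨k, l, hk, hl, hkN, hlN, h0, h1⟩ := exists_even_site hR hN (hG q hq).1 (hG q hq).2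
    have hk' : |k + 1| ≤ N := by
      rw [abs_lt] at hkN
      rw [abs_le]
      omega
    refine ⟨edgeCenter R N k l, PatchworkParams.mem_limitCurve_of_isMax
      (v := HexIndex.mk k l hkN.le hlN.le) (w := HexIndex.mk (k + 1) l hk' hlN.le)
      (hexSign_pos_iff.2 ⟨hk, hl, hkN, hlN, q, hq, h0, h1⟩)
      -- The neighbour is negative by parity, whatever `G` is.
      (hexSign_neg_iff.2 fun h => Int.not_even_iff_odd.2 hk.add_one h.1)
      (lin_edgeCenter_le hR hN _ _ _) (lin_edgeCenter_eq hR hN _ _ _ _),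
      edist_le_of_abs_sub_le hR hN hε ?_ ?_⟩ <;>
    simp only [edgeCenter, PiLp.toLp_apply, Matrix.cons_val_zero, Matrix.cons_val_one] <;>
    rw [mul_div_cancel_left₀ _ hR.ne', mul_div_cancel₀ _ hN'.ne'] <;>
    rw [abs_le] at h0 h1 ⊢ <;> constructor <;> linarith

/-- Every subset of the open box is approximated to within `ε` by a hex-curve of width
`O(1 / ε ^ 2)`. -/
theorem exists_hexCurve_approx {G : Set Plane} {R : ℝ} (hR : 0 < R)
    (hG : ∀ p ∈ G, |p 0| < R ∧ |p 1| < R) {ε : ℝ} (hε : 0 < ε) (hε1 : ε ≤ 1) :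
    ∃ (N : ℕ) (s : HexIndex N → ℝ), 0 < N ∧ (∀ i, s i = 1 ∨ s i = -1) ∧
      IsPatchworkOfWidth ((2 * N + 1) ^ 2) (hexCurve R N s) ∧
      (((2 * N + 1) ^ 2 : ℕ) : ℝ) ≤ (3 * (16 * R + 1)) ^ 2 / ε ^ 2 ∧
      Metric.hausdorffEDist (hexCurve R N s) G ≤ ENNReal.ofReal ε := by
  have hpos : 0 < 16 * R / ε := by positivity
  have hN : 0 < ⌈16 * R / ε⌉₊ := Nat.ceil_pos.2 hpos
  refine ⟨⌈16 * R / ε⌉₊, hexSign G R _, hN, hexSign_eq_one_or G R _,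
    isPatchworkOfWidth_hexCurve _ _ _, ?_,
    hausdorffEDist_hexCurve_le hR hG hN ((div_le_iff₀ hε).1 (Nat.le_ceil _))⟩
  have hlt := Nat.ceil_lt_add_one hpos.le
  have hone : (1 : ℝ) ≤ ⌈16 * R / ε⌉₊ := by exact_mod_cast hN
  push_cast
  rw [← div_pow]
  gcongr
  -- With `N ≥ 1`, `2N + 1 ≤ 3N ≤ 3 (16R / ε + 1)`, and `ε ≤ 1` absorbs the last 1.
  have h1 : 1 ≤ 1 / ε := by rwa [le_div_iff₀ hε, one_mul]
  have e : 3 * (16 * R + 1) / ε = 3 * (16 * R / ε + 1 / ε) := by ring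
  rw [e]
  linarith

theorem exists_box_of_isCompact {G : Set Plane} (hG : IsCompact G) :
    ∃ R : ℝ, 0 < R ∧ ∀ p ∈ G, |p 0| < R ∧ |p 1| < R := by
  obtain ⟨R, hR, h⟩ := hG.isBounded.exists_pos_norm_lt
  exact ⟨R, hR, fun p hp =>
    ⟨(PiLp.norm_apply_le p 0).trans_lt (h p hp), (PiLp.norm_apply_le p 1).trans_lt (h p hp)⟩⟩

theorem IsJordanCurve.isCompact {Γ : Set Plane} (h : IsJordanCurve Γ) : IsCompact Γ := by
  obtain ⟨γ, hγ, -, rfl⟩ := h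
  exact isCompact_range hγ

theorem IsSmoothJordanCurve.isJordanCurve {Γ : Set Plane} (h : IsSmoothJordanCurve Γ) :
    IsJordanCurve Γ := by
  obtain ⟨γ, hγ, hinj, -, -, hrange⟩ := h
  exact ⟨γ, hγ, hinj, hrange⟩

theorem theoremB1 :
    (∀ Γ : Set Plane, IsJordanCurve Γ → ∀ ε : ℝ, 0 < ε →
      ∃ (n : ℕ) (S : Set Plane), IsPatchworkOfWidth n S ∧
        Metric.hausdorffEDist S Γ ≤ ENNReal.ofReal ε) ∧
    (∀ Γ : Set Plane, IsSmoothJordanCurve Γ →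
      ∃ C : ℝ, 0 < C ∧ ∀ ε : ℝ, 0 < ε → ε ≤ 1 →
        ∃ (n : ℕ) (S : Set Plane), IsPatchworkOfWidth n S ∧ (n : ℝ) ≤ C / ε ^ 2 ∧
          Metric.hausdorffEDist S Γ ≤ ENNReal.ofReal ε) ∧
    (∀ Γ : Set Plane, IsSmoothJordanCurve Γ →
      ∀ R : ℝ, 0 < R → (∀ p ∈ Γ, |p 0| < R ∧ |p 1| < R) →
        ∃ C : ℝ, 0 < C ∧ ∀ ε : ℝ, 0 < ε → ε ≤ 1 →
          ∃ (N : ℕ) (s : HexIndex N → ℝ), 0 < N ∧ (∀ i, s i = 1 ∨ s i = -1) ∧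
            IsPatchworkOfWidth ((2 * N + 1) ^ 2) (hexCurve R N s) ∧
            (((2 * N + 1) ^ 2 : ℕ) : ℝ) ≤ C / ε ^ 2 ∧
            Metric.hausdorffEDist (hexCurve R N s) Γ ≤ ENNReal.ofReal ε) := by

  refine ⟨fun Γ hΓ ε hε => ?_, fun Γ hΓ => ?_, fun Γ _ R hR hbox => ?_⟩
  · obtain ⟨R, hR, hbox⟩ := exists_box_of_isCompact hΓ.isCompact
    obtain ⟨N, s, -, -, hS, -, hd⟩ := exists_hexCurve_approx hR hbox (lt_min hε one_pos)
      (min_le_right ε 1)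
    exact ⟨_, _, hS, hd.trans (ENNReal.ofReal_le_ofReal (min_le_left ε 1))⟩
  · obtain ⟨R, hR, hbox⟩ := exists_box_of_isCompact hΓ.isJordanCurve.isCompact
    refine ⟨(3 * (16 * R + 1)) ^ 2, by positivity, fun ε hε hε1 => ?_⟩
    obtain ⟨N, s, -, -, hS, hw, hd⟩ := exists_hexCurve_approx hR hbox hε hε1
    exact ⟨_, _, hS, hw, hd⟩
  · exact ⟨(3 * (16 * R + 1)) ^ 2, by positivity, fun ε hε hε1 =>
      exists_hexCurve_approx hR hbox hε hε1⟩
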